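/- Conventions. All rings are commutative. Let $(R,\mathfrak m)$ be a Noetherian local ring and $M$ a finitely generated $R$-module. The depth of $M$ is the supremum of the lengths of $M$-regular sequences of elements of $\mathfrak m$, and $M$ is Cohen-Macaulay if $M=0$ or $\operatorname{depth}_R M=\dim_R M$. For $M\neq 0$ put $\mathcal S(M)=\{\dim_R N \mid N \text{ an } R\text{-submodule of } M,\ N\neq 0\}=\{d_1<d_2<\dots<d_\ell\}$. The dimension filtration of $M$ is the chain $0=D_0\subsetneq D_1\subsetneq\dots\subsetneq D_\ell=M$ in which, for $1\le i\le \ell$, $D_i$ is the largest $R$-submodule of $M$ with $\dim_R D_i\le d_i$ (here $\dim_R 0=-\infty$). One says that $M$ is a sequentially Cohen-Macaulay $R$-module if $D_i/D_{i-1}$ is Cohen-Macaulay for every $1\le i\le\ell$, and that $R$ is a sequentially Cohen-Macaulay local ring if $\dim R<\infty$ and $R$ is a sequentially Cohen-Macaulay module over itself. Corollary. Let $A$ be a Noetherian local ring and let $G$ be a finite subgroup of the group $\operatorname{Aut}A$ of ring automorphisms of $A$. Suppose that the order of $G$ is invertible in $A$. If $A$ is a sequentially Cohen-Macaulay local ring,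 then the invariant subring $A^G=\{a\in A\mid g(a)=a\text{ for all }g\in G\}$ is a Noetherian local ring and is a sequentially Cohen-Macaulay local ring. -/

import Mathlib

/-- The depth of a finitely generated module `M` over a local ring `R`: the supremum of the lengths
of the `M`-regular sequences consisting of elements of the maximal ideal. -/
noncomputable def moduleDepth (R : Type*) [CommRing R] [IsLocalRing R]
    (M : Type*) [AddCommGroup M] [Module R M] : ℕ∞ :=
  ⨆ (rs : List R) (_ : ∀ r ∈ rs, r ∈ IsLocalRing.maximalIdeal R)
    (_ : RingTheory.Sequence.IsRegular M rs), (rs.length : ℕ∞)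

/-- A finitely generated module over a Noetherian local ring is Cohen-Macaulay if it is zero or if
its depth equals its dimension. -/
def IsCohenMacaulayModule (R : Type*) [CommRing R] [IsLocalRing R]
    (M : Type*) [AddCommGroup M] [Module R M] : Prop :=
  Subsingleton M ∨ (moduleDepth R M : WithBot ℕ∞) = Module.supportDim R M

/-- The set `𝒮(M)` of the dimensions of the nonzero submodules of `M`. -/
def submoduleDims (R : Type*) [CommRing R] (M : Type*) [AddCommGroup M] [Module R M] :
    Set (WithBot ℕ∞) :=
  {d | ∃ N : Submodule R M, N ≠ ⊥ ∧ Module.supportDim R N = d}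

/-- `D 0, …, D ℓ` is the dimension filtration of `M`: writing `𝒮(M) = {d₁ < ⋯ < d_ℓ}`, one has
`D 0 = 0`, and `D i` is the largest submodule of `M` of dimension at most `dᵢ` for `1 ≤ i ≤ ℓ`.
(Below, `d i` for `i : Fin ℓ` is `dᵢ₊₁`.) -/
def IsDimensionFiltration (R : Type*) [CommRing R] {M : Type*} [AddCommGroup M] [Module R M]
    {ℓ : ℕ} (D : Fin (ℓ + 1) → Submodule R M) : Prop :=
  D 0 = ⊥ ∧
    ∃ d : Fin ℓ → WithBot ℕ∞, StrictMono d ∧ Set.range d = submoduleDims R M ∧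
      ∀ i : Fin ℓ, IsGreatest {N : Submodule R M | Module.supportDim R N ≤ d i} (D i.succ)

/-- `M` is a sequentially Cohen-Macaulay module over the local ring `R`: all the quotients
`D i / D (i - 1)`, `1 ≤ i ≤ ℓ`, of its dimension filtration are Cohen-Macaulay. -/
def IsSequentiallyCMModule (R : Type*) [CommRing R] [IsLocalRing R]
    (M : Type*) [AddCommGroup M] [Module R M] : Prop :=
  ∃ (ℓ : ℕ) (D : Fin (ℓ + 1) → Submodule R M), IsDimensionFiltration R D ∧
    ∀ i : Fin ℓ,
      IsCohenMacaulayModule R (D i.succ ⧸ (D i.castSucc).submoduleOf (D i.succ))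

/-- A local ring `R` is sequentially Cohen-Macaulay if it has finite dimension and is a sequentially
Cohen-Macaulay module over itself. -/
def IsSequentiallyCMRing (R : Type*) [CommRing R] [IsLocalRing R] : Prop :=
  ringKrullDim R < ⊤ ∧ IsSequentiallyCMModule R R

/-!
If some `t : A` has trace `∑ g, g • t = 1`, then `x ↦ ∑ g, g • (t * x)` is an `Aᴳ`-linear
retraction of `A` onto `Aᴳ`. For `t = |G|⁻¹` it is the Reynolds operator. Moreover, the `A`-span in
`A ^ G` of the orbit vectors `(g • a)_g`, `a ∈ N`, determines the `Aᴳ`-submodule `N` of `A`: apply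
`f ↦ ∑ h, h • f h⁻¹` to `t • (g • a)_g`. So `A` is a Noetherian `Aᴳ`-module.

Now let `R → S` be a finite homomorphism of Noetherian local rings and `N` an `R`-module which is a
retract of a finitely generated `S`-module `M`. Passing to the `S`-span preserves the dimension of
submodules, so the members of the dimension filtration of `N` are the preimages of members of that
of `M`, and the retraction maps the latter onto the former. Hence each quotient of the filtration
of `N` is a retract of one for `M`. Finally, Cohen-Macaulayness descends to retracts: the dimension
does not grow, and by Rees' theorem every regular sequence in the maximal ideal of `S` can be
replaced by one of the same length in the maximal ideal of `R`, which stays regular on the retract.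
-/

open Module RingTheory.Sequence IsLocalRing Order

universe u

section Dimension

theorem ringKrullDim_eq_of_isIntegral {R S : Type*} [CommRing R] [CommRing S] [Algebra R S]
    [Algebra.IsIntegral R S] (hinj : Function.Injective (algebraMap R S)) :
    ringKrullDim R = ringKrullDim S := by
  refine le_antisymm (iSup_le fun l ↦ ?_)
    (krullDim_le_of_strictMono (PrimeSpectrum.comap (algebraMap R S))
      fun _ _ h ↦ Ideal.IsIntegral.comap_lt_comap h)
  obtain ⟨P, -, _, hP⟩ := Ideal.exists_ideal_over_prime_of_isIntegral (S := S) l.head.asIdeal ⊥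
    (by simp [← RingHom.ker_eq_comap_bot, (RingHom.injective_iff_ker_eq_bot _).mp hinj])
  have : P.LiesOver l.head.asIdeal := ⟨hP.symm⟩
  obtain ⟨L, hL, -, -⟩ := Ideal.exists_ltSeries_of_hasGoingUp l P
  exact hL ▸ L.length_le_krullDim

theorem supportDim_eq_of_comap_annihilator_eq {R S M N : Type*} [CommRing R] [CommRing S]
    [Algebra R S] [Algebra.IsIntegral R S] [AddCommGroup M] [Module S M] [Module.Finite S M]
    [AddCommGroup N] [Module R N] [Module.Finite R N]
    (h : (annihilator S M).comap (algebraMap R S) = annihilator R N) :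
    supportDim S M = supportDim R N := by
  rw [supportDim_eq_ringKrullDim_quotient_annihilator,
    supportDim_eq_ringKrullDim_quotient_annihilator, ← h]
  exact (ringKrullDim_eq_of_isIntegral Ideal.algebraMap_quotient_injective).symm

variable (R S M : Type*) [CommRing R] [CommRing S] [Algebra R S] [Algebra.IsIntegral R S]
  [AddCommGroup M] [Module R M] [Module S M] [IsScalarTower R S M]

theorem supportDim_eq_of_isIntegral [Module.Finite R M] :
    supportDim S M = supportDim R M := by
  have : Module.Finite S M := .of_restrictScalars_finite R S M
  exact supportDim_eq_of_comap_annihilator_eq (by ext; simp [mem_annihilator])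

variable {R M} in
theorem supportDim_span_eq {N : Submodule R M} (hN : N.FG) :
    supportDim S (Submodule.span S (N : Set M)) = supportDim R N := by
  have : Module.Finite R N := .of_fg hN
  have : Module.Finite S (Submodule.span S (N : Set M)) := .of_fg (hN.span)
  refine supportDim_eq_of_comap_annihilator_eq ?_
  ext a
  change algebraMap R S a ∈ (Submodule.span S (N : Set M)).annihilator ↔ a ∈ N.annihilator
  rw [Submodule.mem_annihilator_span, Submodule.mem_annihilator]
  simp

end Dimension

section Regular

theorem exists_mem_isSMulRegular_algebraMap {R S M : Type*} [CommRing R] [CommRing S]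
    [IsNoetherianRing S] [Algebra R S] [AddCommGroup M] [Module S M] [Module.Finite S M]
    (I : Ideal R) (h : Subsingleton ((S ⧸ I.map (algebraMap R S)) →ₗ[S] M)) :
    ∃ x ∈ I, IsSMulRegular M (algebraMap R S x) := by
  by_contra! hI
  -- prime avoidance for the contractions to `R` of the associated primes of `M`
  obtain ⟨P, hP, hIP⟩ : ∃ P ∈ associatedPrimes S M, I ≤ P.comap (algebraMap R S) := by
    refine (Ideal.subset_union_prime_finite (associatedPrimes.finite S M) ⊥ ⊥
      fun P hP _ _ ↦ have := hP.isPrime; P.comap_isPrime _).mp fun x hx ↦ ?_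
    have : algebraMap R S x ∈ ⋃ P ∈ associatedPrimes S M, (P : Set S) := by
      rw [biUnion_associatedPrimes_eq_compl_regular]
      exact hI x hx
    simpa using this
  obtain ⟨hprime, y, hy⟩ := isAssociatedPrime_iff.mp hP
  have hmem (s : S) : s ∈ P ↔ s • y = 0 := by simp [hy, Submodule.mem_colon_singleton]
  have hker : I.map (algebraMap R S) ≤ LinearMap.ker (LinearMap.toSpanSingleton S M y) :=
    fun s hs ↦ (hmem s).mp (Ideal.map_le_iff_le_comap.mpr hIP hs)
  have hy0 : (1 : S) • y = 0 :=
    LinearMap.congr_fun (Subsingleton.elim (Submodule.liftQ _ _ hker) 0) (Submodule.Quotient.mk 1)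
  exact hprime.one_notMem ((hmem 1).mpr hy0)

open CategoryTheory Abelian Limits in
theorem subsingleton_ext_quotSMulTop {S : Type u} [CommRing S] {N M : ModuleCat.{u} S} {x : S}
    (hx : IsSMulRegular M x) (i : ℕ) [Subsingleton (Ext N M i)]
    [Subsingleton (Ext N M (i + 1))] :
    Subsingleton (Ext N (ModuleCat.of S (QuotSMulTop x M)) i) :=
  AddCommGrpCat.subsingleton_of_isZero <| ShortComplex.Exact.isZero_of_both_zeros
    (Ext.covariant_sequence_exact₃' N hx.smulShortComplex_shortExact i (i + 1) rfl)
    ((AddCommGrpCat.isZero_of_iff_subsingleton.mpr ‹_›).eq_zero_of_src _)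
    ((AddCommGrpCat.isZero_of_iff_subsingleton.mpr ‹_›).eq_zero_of_tgt _)

open CategoryTheory Abelian in
theorem exists_isWeaklyRegular_map_of_subsingleton_ext {R : Type*} {S : Type u} [CommRing R]
    [CommRing S] [IsNoetherianRing S] [Algebra R S] (I : Ideal R) (n : ℕ) (M : ModuleCat.{u} S)
    [Module.Finite S M]
    (h : ∀ i < n, Subsingleton (Ext (ModuleCat.of S (S ⧸ I.map (algebraMap R S))) M i)) :
    ∃ rs : List R, rs.length = n ∧ (∀ r ∈ rs, r ∈ I) ∧
      IsWeaklyRegular M (rs.map (algebraMap R S)) := by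
  induction n generalizing M with
  | zero => exact ⟨[], by simp⟩
  | succ n ih =>
    have := h 0 n.zero_lt_succ
    obtain ⟨x, hxI, hx⟩ := exists_mem_isSMulRegular_algebraMap I
      (Ext.addEquiv₀.trans (ModuleCat.homAddEquiv (M := .of S (S ⧸ I.map (algebraMap R S)))
        (N := M))).symm.subsingleton
    obtain ⟨rs, hlen, hmem, hreg⟩ := ih (ModuleCat.of S (QuotSMulTop (algebraMap R S x) M))
      fun i hi ↦
        have := h i (by omega)
        have := h (i + 1) (by omega)
        subsingleton_ext_quotSMulTop hx i
    exact ⟨x :: rs, by simpa using hlen, by simpa using ⟨hxI, hmem⟩, by simpa using ⟨hx, hreg⟩⟩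

theorem exists_isWeaklyRegular_of_le_radical_map {R : Type*} {S M : Type u} [CommRing R]
    [CommRing S] [IsNoetherianRing S] [Algebra R S] [AddCommGroup M] [Module S M]
    [Module.Finite S M] [Module R M] [IsScalarTower R S M] {I : Ideal R} {J : Ideal S}
    (hJ : J ≤ (I.map (algebraMap R S)).radical) (hJM : J • (⊤ : Submodule S M) < ⊤) {ss : List S}
    (hmem : ∀ s ∈ ss, s ∈ J) (hss : IsRegular M ss) :
    ∃ rs : List R, rs.length = ss.length ∧ (∀ r ∈ rs, r ∈ I) ∧ IsWeaklyRegular M rs := by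
  have hsupp : support S (S ⧸ I.map (algebraMap R S)) ⊆ PrimeSpectrum.zeroLocus J := by
    rwa [support_eq_zeroLocus, Ideal.annihilator_quotient,
      PrimeSpectrum.zeroLocus_subset_zeroLocus_iff]
  obtain ⟨rs, hlen, hrs, hreg⟩ := exists_isWeaklyRegular_map_of_subsingleton_ext I ss.length
    (ModuleCat.of S M) <| ModuleCat.subsingleton_ext_of_exists_isRegular J
      (ModuleCat.of S (S ⧸ I.map (algebraMap R S))) hsupp (ModuleCat.of S M) hJM ss hmem hss
  exact ⟨rs, hlen, hrs, (isWeaklyRegular_map_algebraMap_iff S M rs).mp hreg⟩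

theorem isWeaklyRegular_of_comp_eq_id {R M N : Type*} [CommRing R] [AddCommGroup M] [Module R M]
    [AddCommGroup N] [Module R N] {i : N →ₗ[R] M} {r : M →ₗ[R] N} (h : r ∘ₗ i = LinearMap.id)
    {rs : List R} (hrs : IsWeaklyRegular M rs) : IsWeaklyRegular N rs := by
  induction rs generalizing M N with
  | nil => simp
  | cons x rs ih =>
    rw [isWeaklyRegular_cons_iff] at hrs ⊢
    refine ⟨hrs.1.of_injective i (Function.LeftInverse.injective (LinearMap.congr_fun h)),
      ih (i := QuotSMulTop.map x i) (r := QuotSMulTop.map x r) ?_ hrs.2⟩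
    rw [← QuotSMulTop.map_comp, h, QuotSMulTop.map_id]

end Regular

section Depth

theorem length_le_moduleDepth {R M : Type*} [CommRing R] [IsLocalRing R] [AddCommGroup M]
    [Module R M] {rs : List R} (hmem : ∀ r ∈ rs, r ∈ maximalIdeal R) (hreg : IsRegular M rs) :
    (rs.length : ℕ∞) ≤ moduleDepth R M :=
  le_iSup₂_of_le rs hmem (le_iSup_of_le hreg le_rfl)

theorem moduleDepth_le_supportDim (R M : Type*) [CommRing R] [IsNoetherianRing R] [IsLocalRing R]
    [AddCommGroup M] [Module R M] [Module.Finite R M] [Nontrivial M] :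
    (moduleDepth R M : WithBot ℕ∞) ≤ supportDim R M := by
  obtain ⟨d, hd⟩ := WithBot.ne_bot_iff_exists.mp (supportDim_ne_bot_of_nontrivial R M)
  rw [← hd, WithBot.coe_le_coe]
  refine iSup₂_le fun rs _ ↦ iSup_le fun hreg ↦ WithBot.coe_le_coe.mp ?_
  have := hreg.quot_ofList_smul_nontrivial ⊤
  obtain ⟨e, he⟩ := WithBot.ne_bot_iff_exists.mp
    (supportDim_ne_bot_of_nontrivial R (M ⧸ Ideal.ofList rs • (⊤ : Submodule R M)))
  rw [hd, ← supportDim_add_length_eq_supportDim_of_isRegular rs hreg, ← he]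
  exact WithBot.coe_le_coe.mpr le_add_self

theorem maximalIdeal_le_radical_map (R S : Type*) [CommRing R] [IsLocalRing R] [CommRing S]
    [IsLocalRing S] [Algebra R S] [Algebra.IsIntegral R S] :
    maximalIdeal S ≤ ((maximalIdeal R).map (algebraMap R S)).radical := by
  rw [Ideal.radical_eq_sInf]
  refine le_sInf fun P ⟨hP, _⟩ ↦ ?_
  have hle : maximalIdeal R ≤ P.comap (algebraMap R S) := Ideal.map_le_iff_le_comap.mp hP
  have hmax : (P.comap (algebraMap R S)).IsMaximal := by
    rw [← (maximalIdeal.isMaximal R).eq_of_le (Ideal.IsPrime.ne_top inferInstance) hle]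
    infer_instance
  exact (eq_maximalIdeal (Ideal.IsIntegral.isMaximal_of_isMaximal_comap P hmax)).ge

theorem moduleDepth_le_of_comp_eq_id {R N : Type*} {S M : Type u} [CommRing R] [IsLocalRing R]
    [CommRing S] [IsNoetherianRing S] [IsLocalRing S] [Algebra R S] [Algebra.IsIntegral R S]
    [AddCommGroup M] [Module S M] [Module.Finite S M] [Module R M] [IsScalarTower R S M]
    [AddCommGroup N] [Module R N] [Module.Finite R N] [Nontrivial N] {i : N →ₗ[R] M}
    {r : M →ₗ[R] N} (h : r ∘ₗ i = LinearMap.id) : moduleDepth S M ≤ moduleDepth R N := by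
  refine iSup₂_le fun ss hss ↦ iSup_le fun hreg ↦ ?_
  have : Nontrivial M := hreg.nontrivial
  have hlt : maximalIdeal S • (⊤ : Submodule S M) < ⊤ := lt_top_iff_ne_top.mpr
    (Submodule.top_ne_ideal_smul_of_le_jacobson_annihilator (maximalIdeal_le_jacobson _)).symm
  obtain ⟨rs, hlen, hrs, hreg'⟩ :=
    exists_isWeaklyRegular_of_le_radical_map (maximalIdeal_le_radical_map R S) hlt hss hreg
  exact hlen ▸ length_le_moduleDepth hrs
    (.of_isWeaklyRegular_of_mem_maximalIdeal N hrs (isWeaklyRegular_of_comp_eq_id h hreg'))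

theorem IsCohenMacaulayModule.of_comp_eq_id {R N : Type*} {S M : Type u} [CommRing R]
    [IsNoetherianRing R] [IsLocalRing R] [CommRing S] [IsLocalRing S] [Algebra R S]
    [Module.Finite R S] [AddCommGroup M] [Module S M] [Module.Finite S M] [Module R M]
    [IsScalarTower R S M] [AddCommGroup N] [Module R N] {i : N →ₗ[R] M} {r : M →ₗ[R] N}
    (h : r ∘ₗ i = LinearMap.id) (hM : IsCohenMacaulayModule S M) : IsCohenMacaulayModule R N := by
  obtain hN | hN := subsingleton_or_nontrivial N
  · exact .inl hN
  have : IsNoetherianRing S := .of_finite R S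
  have : Module.Finite R M := .trans S M
  have hri : Function.LeftInverse r i := LinearMap.congr_fun h
  have : Module.Finite R N := .of_surjective r hri.surjective
  have : Nontrivial M := hri.injective.nontrivial
  refine .inr (le_antisymm (moduleDepth_le_supportDim R N) ?_)
  calc supportDim R N ≤ supportDim R M := supportDim_le_of_injective i hri.injective
    _ = supportDim S M := (supportDim_eq_of_isIntegral R S M).symm
    _ = moduleDepth S M := (hM.resolve_left (not_subsingleton M)).symm
    _ ≤ moduleDepth R N := WithBot.coe_le_coe.mpr (moduleDepth_le_of_comp_eq_id h)

end Depth

section DimensionFiltration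

/-- `D` is the largest submodule of `M` whose dimension lies in `T`. For `T = Set.Iic c` and
`T = Set.Iio c`, where `c` is the dimension of a nonzero submodule, these are two consecutive
members of the dimension filtration. -/
def IsLargestOfDimIn (R : Type*) [CommRing R] {M : Type*} [AddCommGroup M] [Module R M]
    (T : Set (WithBot ℕ∞)) (D : Submodule R M) : Prop :=
  IsGreatest {N : Submodule R M | supportDim R N ∈ T} D

section

variable {R M : Type*} [CommRing R] [AddCommGroup M] [Module R M]

theorem bot_lt_of_mem_submoduleDims {c : WithBot ℕ∞} (hc : c ∈ submoduleDims R M) : ⊥ < c := by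
  obtain ⟨N, hN, rfl⟩ := hc
  have := Submodule.nontrivial_iff_ne_bot.mpr hN
  exact bot_lt_iff_ne_bot.mpr (supportDim_ne_bot_of_nontrivial R N)

theorem supportDim_eq_bot_or_mem_submoduleDims (N : Submodule R M) :
    supportDim R N = ⊥ ∨ supportDim R N ∈ submoduleDims R M := by
  by_cases hN : N = ⊥
  · exact .inl (hN ▸ supportDim_eq_bot_of_subsingleton R _)
  · exact .inr ⟨N, hN, rfl⟩

theorem isLargestOfDimIn_Iio_bot {c : WithBot ℕ∞}
    (hc : IsLeast (submoduleDims R M) c) :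
    IsLargestOfDimIn R (Set.Iio c) (⊥ : Submodule R M) := by
  refine ⟨?_, fun N hN ↦ ?_⟩
  · exact (supportDim_eq_bot_of_subsingleton R _).trans_lt (bot_lt_of_mem_submoduleDims hc.1)
  · by_contra hbot
    exact (hc.2 ⟨N, fun h ↦ hbot h.le, rfl⟩).not_gt hN

theorem isLargestOfDimIn_castSucc {ℓ : ℕ} {D : Fin (ℓ + 1) → Submodule R M} (h0 : D 0 = ⊥)
    {d : Fin ℓ → WithBot ℕ∞} (hmono : StrictMono d) (hd : Set.range d = submoduleDims R M)
    (hD : ∀ i, IsLargestOfDimIn R (Set.Iic (d i)) (D i.succ)) (i : Fin ℓ) :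
    IsLargestOfDimIn R (Set.Iio (d i)) (D i.castSucc) := by
  obtain _ | ℓ := ℓ
  · exact i.elim0
  cases i using Fin.cases with
  | zero =>
    rw [Fin.castSucc_zero, h0]
    refine isLargestOfDimIn_Iio_bot ⟨hd ▸ Set.mem_range_self 0, ?_⟩
    rw [← hd]
    rintro _ ⟨j, rfl⟩
    exact hmono.monotone (Fin.zero_le j)
  | succ j =>
    have hiff (N : Submodule R M) : supportDim R N ∈ Set.Iio (d j.succ) ↔
        supportDim R N ∈ Set.Iic (d j.castSucc) := by
      refine ⟨fun hN ↦ ?_, fun hN ↦ hN.trans_lt (hmono j.castSucc_lt_succ)⟩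
      obtain hN' | hN' := supportDim_eq_bot_or_mem_submoduleDims N
      · exact hN'.trans_le bot_le
      · obtain ⟨k, hk⟩ := hd ▸ hN'
        rw [← hk] at hN ⊢
        exact hmono.monotone (Fin.le_castSucc_iff.mpr (hmono.lt_iff_lt.mp hN))
    rw [← Fin.succ_castSucc]
    simpa only [IsLargestOfDimIn, hiff] using hD j.castSucc

theorem isSequentiallyCMModule_iff [IsLocalRing R] :
    IsSequentiallyCMModule R M ↔ (submoduleDims R M).Finite ∧
      ∀ c ∈ submoduleDims R M, ∃ D D' : Submodule R M,
        IsLargestOfDimIn R (Set.Iic c) D ∧ IsLargestOfDimIn R (Set.Iio c) D' ∧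
        IsCohenMacaulayModule R (D ⧸ D'.submoduleOf D) := by
  constructor
  · rintro ⟨ℓ, D, ⟨h0, d, hmono, hd, hD⟩, hCM⟩
    rw [← hd, Set.forall_mem_range]
    exact ⟨Set.finite_range d, fun i ↦
      ⟨_, _, hD i, isLargestOfDimIn_castSucc h0 hmono hd hD i, hCM i⟩⟩
  · rintro ⟨hfin, h⟩
    choose! D D' hD hD' hCM using h
    let d := hfin.toFinset.orderEmbOfFin rfl
    have hd : Set.range d = submoduleDims R M := by simp [d]
    have hmem (i) : d i ∈ submoduleDims R M := hd.le (Set.mem_range_self i)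
    let E : Fin (hfin.toFinset.card + 1) → Submodule R M := Fin.cons ⊥ fun i ↦ D (d i)
    have hE (i : Fin hfin.toFinset.card) : IsLargestOfDimIn R (Set.Iic (d i)) (E i.succ) :=
      hD _ (hmem i)
    refine ⟨_, E, ⟨rfl, d, d.strictMono, hd, hE⟩, fun i ↦ ?_⟩
    have hE' : E i.castSucc = D' (d i) :=
      (isLargestOfDimIn_castSucc rfl d.strictMono hd hE i).unique (hD' _ (hmem i))
    exact hE' ▸ hCM _ (hmem i)

end

section Retract

variable {R N S M : Type*} [CommRing R] [CommRing S] [Algebra R S] [AddCommGroup M] [Module S M]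
  [Module R M] [IsScalarTower R S M] [AddCommGroup N] [Module R N]

theorem exists_comp_eq_id_quotient_submoduleOf {i : N →ₗ[R] M} {r : M →ₗ[R] N}
    (h : r ∘ₗ i = LinearMap.id) {D D' : Submodule S M} {E E' : Submodule R N}
    (hiE : ∀ x ∈ E, i x ∈ D) (hrD : ∀ x ∈ D, r x ∈ E) (hiE' : ∀ x ∈ E', i x ∈ D')
    (hrD' : ∀ x ∈ D', r x ∈ E') :
    ∃ (j : (E ⧸ E'.submoduleOf E) →ₗ[R] (D ⧸ D'.submoduleOf D))
      (s : (D ⧸ D'.submoduleOf D) →ₗ[R] (E ⧸ E'.submoduleOf E)), s ∘ₗ j = LinearMap.id := by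
  let i₀ : E →ₗ[R] D := i.restrict (p := E) (q := D.restrictScalars R) hiE
  let r₀ : D →ₗ[R] E := r.restrict (p := D.restrictScalars R) (q := E) hrD
  let e := Submodule.Quotient.restrictScalarsEquiv R (D'.submoduleOf D)
  refine ⟨e.toLinearMap ∘ₗ Submodule.mapQ _ ((D'.submoduleOf D).restrictScalars R) i₀
      fun x hx ↦ hiE' x hx,
    Submodule.mapQ ((D'.submoduleOf D).restrictScalars R) _ r₀ (fun x hx ↦ hrD' x hx) ∘ₗ
      e.symm.toLinearMap, ?_⟩
  ext x
  change Submodule.Quotient.mk (r₀ (i₀ x)) = Submodule.Quotient.mk x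
  exact congrArg _ (Subtype.ext (LinearMap.congr_fun h x))

theorem supportDim_span_map_eq [IsNoetherianRing R] [Algebra.IsIntegral R S] [Module.Finite R N]
    {i : N →ₗ[R] M} (hi : Function.Injective i) (I : Submodule R N) :
    supportDim S (Submodule.span S (I.map i : Set M)) = supportDim R I :=
  (supportDim_span_eq S ((IsNoetherian.noetherian I).map i)).trans
    (supportDim_eq_of_equiv (I.equivMapOfInjective i hi)).symm

theorem submoduleDims_subset_of_injective [IsNoetherianRing R] [Algebra.IsIntegral R S]
    [Module.Finite R N] {i : N →ₗ[R] M} (hi : Function.Injective i) :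
    submoduleDims R N ⊆ submoduleDims S M := by
  rintro _ ⟨I, hI, rfl⟩
  refine ⟨_, fun hbot ↦ hI ?_, supportDim_span_map_eq hi I⟩
  have := Submodule.span_eq_bot.mp hbot
  exact (Submodule.eq_bot_iff I).mpr fun x hx ↦
    (map_eq_zero_iff i hi).mp (this _ (Submodule.mem_map_of_mem hx))

variable [IsNoetherianRing R] [Module.Finite R M] [Algebra.IsIntegral R S]

theorem IsLargestOfDimIn.comap {i : N →ₗ[R] M} (hi : Function.Injective i)
    {T : Set (WithBot ℕ∞)} (hT : IsLowerSet T) {D : Submodule S M} (hD : IsLargestOfDimIn S T D) :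
    IsLargestOfDimIn R T ((D.restrictScalars R).comap i) := by
  have : Module.Finite R N := .of_injective i hi
  have hspan (I : Submodule R N) :
      Submodule.span S (I.map i : Set M) ≤ D ↔ I ≤ (D.restrictScalars R).comap i := by
    rw [Submodule.span_le, ← Submodule.map_le_iff_le_comap]
    rfl
  constructor
  · rw [Set.mem_ofPred_eq, ← supportDim_span_map_eq (S := S) hi]
    exact hT (supportDim_le_of_injective _ (Submodule.inclusion_injective ((hspan _).mpr le_rfl)))
      hD.1
  · intro I hI
    refine (hspan I).mp (hD.2 ?_)
    rwa [Set.mem_ofPred_eq, supportDim_span_map_eq hi]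

theorem IsLargestOfDimIn.map_mem {r : M →ₗ[R] N} {T : Set (WithBot ℕ∞)} (hT : IsLowerSet T)
    {D : Submodule S M} (hD : IsLargestOfDimIn S T D) {E : Submodule R N}
    (hE : IsLargestOfDimIn R T E) {x : M} (hx : x ∈ D) : r x ∈ E := by
  have : Module.Finite R D := .of_injective (D.subtype.restrictScalars R) Subtype.val_injective
  have hdim : supportDim R ((D.restrictScalars R).map r) ≤ supportDim S D :=
    (supportDim_le_of_surjective (r.submoduleMap (D.restrictScalars R))
      (r.submoduleMap_surjective _)).trans_eq (supportDim_eq_of_isIntegral R S D).symm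
  exact hE.2 (hT hdim hD.1) (Submodule.mem_map_of_mem hx)

end Retract

theorem IsSequentiallyCMModule.of_comp_eq_id {R N : Type*} {S M : Type u} [CommRing R]
    [IsNoetherianRing R] [IsLocalRing R] [CommRing S] [IsLocalRing S] [Algebra R S]
    [Module.Finite R S] [AddCommGroup M] [Module S M] [Module.Finite S M] [Module R M]
    [IsScalarTower R S M] [AddCommGroup N] [Module R N] {i : N →ₗ[R] M} {r : M →ₗ[R] N}
    (h : r ∘ₗ i = LinearMap.id) (hM : IsSequentiallyCMModule S M) :
    IsSequentiallyCMModule R N := by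
  have : IsNoetherianRing S := .of_finite R S
  have : Module.Finite R M := .trans S M
  have hi : Function.Injective i := Function.LeftInverse.injective (LinearMap.congr_fun h)
  have : Module.Finite R N := .of_injective i hi
  have hsub : submoduleDims R N ⊆ submoduleDims S M := submoduleDims_subset_of_injective hi
  obtain ⟨hfin, hCM⟩ := isSequentiallyCMModule_iff.mp hM
  refine isSequentiallyCMModule_iff.mpr ⟨hfin.subset hsub, fun c hc ↦ ?_⟩
  obtain ⟨D, D', hD, hD', hQ⟩ := hCM c (hsub hc)
  have hE := hD.comap hi (isLowerSet_Iic c)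
  have hE' := hD'.comap hi (isLowerSet_Iio c)
  obtain ⟨j, s, hsj⟩ := exists_comp_eq_id_quotient_submoduleOf h (fun _ hx ↦ hx)
    (fun _ ↦ hD.map_mem (isLowerSet_Iic c) hE) (fun _ hx ↦ hx)
    (fun _ ↦ hD'.map_mem (isLowerSet_Iio c) hE')
  exact ⟨_, _, hE, hE', hQ.of_comp_eq_id hsj⟩

end DimensionFiltration

section Invariants

variable (G A : Type*) [Group G] [Fintype G] [CommRing A] [MulSemiringAction G A]

/-- The trace `x ↦ ∑ g, g • x` of a finite group action, as a linear map from a ring to its ring of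
invariants. -/
def invariantTrace : A →ₗ[FixedPoints.subring A G] FixedPoints.subring A G where
  toFun x := ⟨∑ g : G, g • x, fun h ↦ by
    simp_rw [Finset.smul_sum, smul_smul]
    exact Fintype.sum_equiv (Equiv.mulLeft h) _ _ fun _ ↦ rfl⟩
  map_add' x y := by
    ext
    simp [Finset.sum_add_distrib]
  map_smul' b x := by
    ext
    change ∑ g : G, g • (b • x) = b • ∑ g : G, g • x
    simp only [Finset.smul_sum, smul_comm _ b]

/-- The sum over `h : G` of the entries at `h⁻¹` of a vector in `A ^ G`, moved back by `h`. It
recovers `a`, up to an invariant factor, from a multiple of its orbit vector `(g • a)_g`. -/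
def twistedTrace : (G → A) →+ A where
  toFun f := ∑ h : G, h • f h⁻¹
  map_zero' := by simp
  map_add' f f' := by simp [Finset.sum_add_distrib]

variable {G A}

theorem coe_invariantTrace (x : A) : (invariantTrace G A x : A) = ∑ g : G, g • x := rfl

theorem exists_sum_smul_eq_one (hG : IsUnit (Fintype.card G : A)) :
    ∃ t : A, ∑ g : G, g • t = 1 := by
  obtain ⟨t, ht⟩ := hG.exists_right_inv
  refine ⟨t, hG.mul_left_cancel ?_⟩
  calc (Fintype.card G : A) * ∑ g : G, g • t = ∑ g : G, g • ((Fintype.card G : A) * t) := by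
        simp only [← nsmul_eq_mul, Finset.smul_sum, smul_comm (Fintype.card G)]
    _ = Fintype.card G * 1 := by simp [ht]

theorem invariantTrace_comp_mulLeft_comp_linearMap {t : A} (ht : ∑ g : G, g • t = 1) :
    (invariantTrace G A ∘ₗ LinearMap.mulLeft (FixedPoints.subring A G) t) ∘ₗ
      Algebra.linearMap (FixedPoints.subring A G) A = LinearMap.id := by
  ext
  simpa [coe_invariantTrace] using ht

theorem twistedTrace_smul_orbit (b a : A) :
    twistedTrace G A (b • fun g ↦ g • a) = invariantTrace G A b • a := by
  change ∑ h : G, h • (b * h⁻¹ • a) = (∑ h : G, h • b) * a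
  simp [smul_mul', Finset.sum_mul]

theorem orbit_mem_span_iff {t : A} (ht : ∑ g : G, g • t = 1)
    (N : Submodule (FixedPoints.subring A G) A) (a : A) :
    (fun g : G ↦ g • a) ∈ Submodule.span A ((fun a g ↦ g • a) '' (N : Set A)) ↔ a ∈ N := by
  refine ⟨fun ha ↦ ?_, fun ha ↦ Submodule.subset_span ⟨a, ha, rfl⟩⟩
  have hN (f : G → A) (hf : f ∈ Submodule.span A ((fun a g ↦ g • a) '' (N : Set A))) :
      twistedTrace G A f ∈ N := by
    obtain ⟨n, b, v, rfl⟩ := Submodule.mem_span_set'.mp hf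
    rw [map_sum]
    refine N.sum_mem fun j _ ↦ ?_
    obtain ⟨x, hx, hv⟩ := (v j).2
    rw [← hv, twistedTrace_smul_orbit]
    exact N.smul_mem _ hx
  have htrace : invariantTrace G A t = 1 := Subtype.ext ht
  simpa [twistedTrace_smul_orbit, htrace] using hN _ (Submodule.smul_mem _ t ha)

theorem isNoetherian_fixedPoints_subring [IsNoetherianRing A]
    (ht : ∃ t : A, ∑ g : G, g • t = 1) : IsNoetherian (FixedPoints.subring A G) A := by
  obtain ⟨t, ht⟩ := ht
  let orbitSpan (N : Submodule (FixedPoints.subring A G) A) : Submodule A (G → A) :=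
    Submodule.span A ((fun a g ↦ g • a) '' (N : Set A))
  have hmono : StrictMono orbitSpan := by
    refine Monotone.strictMono_of_injective
      (fun N N' h ↦ Submodule.span_mono (Set.image_mono h)) fun N N' h ↦ ?_
    ext a
    rw [← orbit_mem_span_iff ht N, ← orbit_mem_span_iff ht N']
    change _ ∈ orbitSpan N ↔ _ ∈ orbitSpan N'
    rw [h]
  rw [isNoetherian_iff']
  exact hmono.wellFoundedGT

end Invariants

theorem corollary3p7_general {G A : Type*} [Group G] [Fintype G] [CommRing A] [IsLocalRing A]
    [IsNoetherianRing A] [MulSemiringAction G A] (ht : ∃ t : A, ∑ g : G, g • t = 1)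
    (hA : IsSequentiallyCMRing A) :
    IsNoetherianRing (FixedPoints.subring A G) ∧
      ∃ _ : IsLocalRing (FixedPoints.subring A G),
        IsSequentiallyCMRing (FixedPoints.subring A G) := by
  have : IsNoetherian (FixedPoints.subring A G) A := isNoetherian_fixedPoints_subring ht
  have hnoeth : IsNoetherianRing (FixedPoints.subring A G) :=
    isNoetherian_of_injective (Algebra.linearMap _ A) Subtype.val_injective
  have hloc : IsLocalRing (FixedPoints.subring A G) :=
    (algebraMap (FixedPoints.subring A G) A).domain_isLocalRing
  obtain ⟨t, ht⟩ := ht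
  exact ⟨hnoeth, hloc, ringKrullDim_lt_top,
    hA.2.of_comp_eq_id (invariantTrace_comp_mulLeft_comp_linearMap ht)⟩

theorem corollary3p7 {A : Type*} [CommRing A] [IsLocalRing A] [IsNoetherianRing A]
    (G : Subgroup (RingAut A)) [Finite G] (hG : IsUnit ((Nat.card G : ℕ) : A))
    (hA : IsSequentiallyCMRing A) :
    IsNoetherianRing (FixedPoints.subring A G) ∧
      ∃ _ : IsLocalRing (FixedPoints.subring A G),
        IsSequentiallyCMRing (FixedPoints.subring A G) := by
  have := Fintype.ofFinite G
  exact corollary3p7_general (exists_sum_smul_eq_one (Nat.card_eq_fintype_card (α := G) ▸ hG)) hA
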